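/- Let $d,r,T\ge 1$ be integers with $T\ge \frac{d}{6r}$, let $p\in[1,2]$, $q=p/(p-1)$ (with $q=\infty$ for $p=1$), and $D,B>0$. Let $\mathbb X_p(D)$ be the collection of nonempty closed convex sets $\mathcal X\subseteq\mathbb R^d$ with $\|x-y\|_p\le D$ for all $x,y\in\mathcal X$. For $\mathcal X\in\mathbb X_p(D)$ let $\mathcal O_{c,p}$ be the set of pairs $(f,O)$ where $f$ is a real function that is convex on $\mathcal X$ and $O$ is a stochastic first-order oracle which answers every query $x\in\mathcal X$ by a random vector $\hat g(x)\in\mathbb R^d$, drawn from a law depending only on $x$ (a Markov kernel), with $\mathbb E[\hat g(x)\mid x]\in\partial f(x)=\{g:\ f(y)\ge f(x)+\langle g,y-x\rangle\ \forall y\in\mathcal X\}$ and $\Pr(\|\hat g(x)\|_q^2\le B^2\mid x)=1$. Let $\mathcal W_{com,r}$ be the set of all channels (Markov kernels) from $\mathbb R^d$ to $\{0,1\}^r$. In each iteration $t=1,\dots,T$, the algorithm $\pi$ chooses a query point $x_t\in\mathcal X$ and the channel selection strategy $S$ chooses a channel $W_t\in\mathcal W_{com,r}$, both as (measurable) functions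 of the previous channel outputs $Y_1,\dots,Y_{t-1}$ and of a shared random seed that is independent of the oracle; the oracle answers $\hat g(x_t)$, and the algorithm observes only $Y_t\sim W_t(\cdot\mid\hat g(x_t))$. After $T$ iterations $\pi$ outputs a point $\hat x\in\mathcal X$, a function of $Y_1,\dots,Y_T$ and of the seed. Let $$\mathcal E^*(\mathcal X,\mathcal O_{c,p},T,\mathcal W_{com,r})=\inf_{\pi,S}\ \sup_{(f,O)\in\mathcal O_{c,p}}\ \mathbb E\Big[f(\hat x)-\min_{x\in\mathcal X}f(x)\Big].$$ Then, with $c_0=\frac{1}{12\sqrt{58}}$, $$\sup_{\mathcal X\in\mathbb X_p(D)}\mathcal E^*(\mathcal X,\mathcal O_{c,p},T,\mathcal W_{com,r})\ \ge\ \frac{c_0\,D\,B}{\sqrt T}\cdot\sqrt{\frac{d}{\min\{d,r\}}}.$$ -/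

import Mathlib

open MeasureTheory ProbabilityTheory
open scoped ENNReal

namespace InfoOpt

/-- The `ℓ_p` norm of a vector of `ℝ^d`, for `p ∈ [1, ∞]`. -/
noncomputable def ellNorm {d : ℕ} (p : ℝ≥0∞) (x : Fin d → ℝ) : ℝ :=
  ‖(WithLp.toLp p x : PiLp p fun _ : Fin d => ℝ)‖

/-- Admissible domains: nonempty closed convex subsets of `ℝ^d` whose `ℓ_p` diameter is at
most `D`. -/
def domains (d : ℕ) (p : ℝ≥0∞) (D : ℝ) : Set (Set (Fin d → ℝ)) :=
  {X | X.Nonempty ∧ IsClosed X ∧ Convex ℝ X ∧ ∀ x ∈ X, ∀ y ∈ X, ellNorm p (x - y) ≤ D}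

/-- The set of subgradients at `x` of a function `f` on the domain `X`. -/
def subdifferential {d : ℕ} (X : Set (Fin d → ℝ)) (f : (Fin d → ℝ) → ℝ) (x : Fin d → ℝ) :
    Set (Fin d → ℝ) :=
  {g | ∀ y ∈ X, f x + g ⬝ᵥ (y - x) ≤ f y}

/-- The convex and `ℓ_p` Lipschitz family over the domain `X`: pairs of a function `f` that is
convex on `X` (its values outside `X` play no role) and a stochastic first-order oracle, which
answers the query `x ∈ X` by a random vector of law `O x`, independently of everything else.
The answers are unbiased subgradient estimates whose `ℓ_q` norm is almost surely at most `B`,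
for `q = p / (p - 1)`. -/
def convexLipschitzFamily {d : ℕ} (p : ℝ≥0∞) (B : ℝ) (X : Set (Fin d → ℝ)) :
    Set (((Fin d → ℝ) → ℝ) × Kernel X (Fin d → ℝ)) :=
  {fO | ConvexOn ℝ X fO.1 ∧ IsMarkovKernel fO.2 ∧
    ∀ x : X, (∫ g, g ∂(fO.2 x)) ∈ subdifferential X fO.1 x ∧
      ∀ᵐ g ∂(fO.2 x), ellNorm p.conjExponent g ^ 2 ≤ B ^ 2}

/-- The `r`-bit communication-constrained channels: all channels (randomized maps, that is
Markov kernels) from `ℝ^d` to `{0, 1}^r`. -/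
def commChannels (d r : ℕ) : Set (Kernel (Fin d → ℝ) (Fin r → Bool)) :=
  {W | IsMarkovKernel W}

/-- A first-order algorithm with `T` queries on the domain `X` which observes channel outputs
with values in `Y`, and may use a random seed with values in `Ω`. The query number `t` depends
on the seed and on the `t` previous channel outputs (queries are counted from zero), and the
final point depends on the seed and on all `T` channel outputs. -/
structure Algorithm {d : ℕ} (X : Set (Fin d → ℝ)) (T : ℕ) (Y Ω : Type)
    [MeasurableSpace Y] [MeasurableSpace Ω] where
  query : (t : Fin T) → Ω → (Fin t → Y) → X
  output : Ω → (Fin T → Y) → X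
  measurable_query : ∀ t : Fin T, Measurable fun z : Ω × (Fin t → Y) => query t z.1 z.2
  measurable_output : Measurable fun z : Ω × (Fin T → Y) => output z.1 z.2

/-- An adaptive channel selection strategy over `T` iterations for the channel family `𝒲`: the
channel of the iteration `t` is chosen in `𝒲` as a function of the `t` previous channel outputs
(and of the random seed that is shared with the algorithm). -/
structure ChannelStrategy {d : ℕ} {Y : Type} [MeasurableSpace Y]
    (𝒲 : Set (Kernel (Fin d → ℝ) Y)) (T : ℕ) (Ω : Type) [MeasurableSpace Ω] where
  channel : (t : Fin T) → Ω → (Fin t → Y) → Kernel (Fin d → ℝ) Y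
  channel_mem : ∀ t ω y, channel t ω y ∈ 𝒲
  measurable_channel : ∀ t : Fin T,
    Measurable fun z : Ω × (Fin t → Y) × (Fin d → ℝ) => channel t z.1 z.2.1 z.2.2

section

variable {d T : ℕ} {X : Set (Fin d → ℝ)} {Y Ω : Type} [MeasurableSpace Y] [MeasurableSpace Ω]
  {𝒲 : Set (Kernel (Fin d → ℝ) Y)}

/-- The law of the first `t` channel outputs for the seed `ω`. In each iteration the oracle `O`
answers the current query, and the answer is passed through the current channel; the output of
the channel is appended to the list of the previous outputs. -/
noncomputable def transcriptLaw (π : Algorithm X T Y Ω) (S : ChannelStrategy 𝒲 T Ω)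
    (O : Kernel X (Fin d → ℝ)) (ω : Ω) : (t : ℕ) → t ≤ T → Measure (Fin t → Y)
  | 0, _ => Measure.dirac fun i => i.elim0
  | t + 1, h => (transcriptLaw π S O ω t (Nat.le_of_succ_le h)).bind fun y =>
      ((O (π.query ⟨t, h⟩ ω y)).bind fun g => S.channel ⟨t, h⟩ ω y g).map
        fun z => Fin.snoc (α := fun _ => Y) y z

/-- The expected optimization error `E [f(output) - min_X f]`. The integrand is nonnegative, and
the expectation is taken as a value in `[0, ∞]`. -/
noncomputable def optError (μ : Measure Ω) (π : Algorithm X T Y Ω) (S : ChannelStrategy 𝒲 T Ω)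
    (f : (Fin d → ℝ) → ℝ) (O : Kernel X (Fin d → ℝ)) : ℝ≥0∞ :=
  ∫⁻ ω, ∫⁻ y, ENNReal.ofReal (f (π.output ω y) - sInf (f '' X))
    ∂(transcriptLaw π S O ω T le_rfl) ∂μ

/-- The adaptive minmax optimization error: infimum over the law of the seed, the algorithm and
the adaptive channel selection strategy, of the worst case over the function and the oracle. -/
noncomputable def minmaxError (X : Set (Fin d → ℝ))
    (𝒪 : Set (((Fin d → ℝ) → ℝ) × Kernel X (Fin d → ℝ))) (T : ℕ)
    (𝒲 : Set (Kernel (Fin d → ℝ) Y)) : ℝ≥0∞ :=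
  ⨅ (Ω : Type) (_ : MeasurableSpace Ω) (μ : Measure Ω) (_ : IsProbabilityMeasure μ)
    (π : Algorithm X T Y Ω) (S : ChannelStrategy 𝒲 T Ω),
    ⨆ fO ∈ 𝒪, optError μ π S fO.1 fO.2

end

end InfoOpt

/-!
The bound comes from linear losses on a cube, which make optimization as hard as estimating a mean.
For a sign vector `v` the loss is `x ↦ b * ε * ∑ i, v i * x i`, and the oracle answers every query,
wherever it is made, by an independent vector with entries `±b` and mean `b * ε * v`
(`signLoss`, `signOracle`). On the cube the excess loss of `x` is the sum over the coordinates of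
how far `x i` is from the vertex coordinate `-a * v i`. So the algorithm has to find most of the
signs `v`, for an average `v`, and it fails if negating one coordinate of `v` hardly changes the law
of the transcript, for most coordinates (`le_sum_signs_sum_error`).

That the law hardly changes is an information bound. The change is measured by the Kullback-Leibler
divergence, which bounds the `ℓ_1` distance (`sq_sum_abs_sub_le_finiteKL`) and which has a chain rule
(`finiteKL_prod`), so that adaptive queries and channels can be treated one output at a time. For
one output `z` of probability `P` let `k i` be the relative change of `P` when `v i` is negated. It is
the conditional mean, given `z`, of a function of the sign `i` of the oracle answer which is centred
and of size at most of order `ε`. Under the law of the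
oracle answer these functions are independent, so by Jensen's inequality and the
subgaussian bound for their linear combinations `∑ i, k i ^ 2` is at most of order
`ε ^ 2 * log (1 / P)` (`sum_sq_outTilt_le`). The mean of this over `z` is `ε ^ 2` times an entropy, which
for `r` bits is at most `r * log 2`; the trivial bound is `d * ε ^ 2`. Altogether `T` outputs carry an
information of order `T * ε ^ 2 * min d r` about the `d` signs
(`sum_finiteKL_transcriptProb_le`).

With `ε` a small multiple of `√(d / (T * min d r))` this is a small multiple of `d`, and the excess
loss is at least a constant times `a * b * d * ε`, where `a * b * d = D * B / 2` by the duality of the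
exponents. The assumption on `T` keeps `ε` below `1 / 4`. All of this holds for each fixed seed, so
that the seed is integrated out only at the end (`le_iSup_optError`).
-/

namespace InfoOpt

/-! ### Kullback-Leibler divergence on finite types -/

/-- The Kullback-Leibler divergence of two mass functions on a finite type. Terms with `P a = 0`
vanish, as they should; where `Q a = 0 < P a` the value is not infinite, so that absolute
continuity is a separate hypothesis wherever it matters. -/
noncomputable def finiteKL {α : Type*} [Fintype α] (P Q : α → ℝ) : ℝ :=
  ∑ a, P a * Real.log (P a / Q a)

/-- A version of Pinsker's inequality, through the Hellinger distance. -/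
theorem sq_sum_abs_sub_le_finiteKL {α : Type*} [Fintype α] {P Q : α → ℝ}
    (hP : ∀ a, 0 ≤ P a) (hQ : ∀ a, 0 ≤ Q a) (hP1 : ∑ a, P a = 1) (hQ1 : ∑ a, Q a = 1)
    (hPQ : ∀ a, 0 < P a → 0 < Q a) :
    (∑ a, |P a - Q a|) ^ 2 ≤ 4 * finiteKL P Q := by
  have hsum (c : ℝ) (hc : c ^ 2 = 1) : ∑ a, (√(P a) + c * √(Q a)) ^ 2
      = 2 + 2 * c * ∑ a, √(P a) * √(Q a) := by
    have h (a : α) : (√(P a) + c * √(Q a)) ^ 2 = P a + Q a + 2 * c * (√(P a) * √(Q a)) := by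
      linear_combination Real.sq_sqrt (hP a) + c ^ 2 * Real.sq_sqrt (hQ a) + Q a * hc
    simp_rw [h, Finset.sum_add_distrib, ← Finset.mul_sum, hP1, hQ1]
    ring
  have hle : ∑ a, (√(P a) + (-1) * √(Q a)) ^ 2 ≤ finiteKL P Q := by
    have h (a : α) : 2 * (P a - √(P a) * √(Q a)) ≤ P a * Real.log (P a / Q a) := by
      rcases (hP a).eq_or_lt with h0 | h0
      · simp [← h0]
      have h1 := hPQ a h0
      have hp := Real.sqrt_pos.2 h0
      have hq := Real.sqrt_pos.2 h1
      have hl := Real.log_le_sub_one_of_pos (div_pos hq hp)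
      have e : Real.log (P a / Q a) = -2 * Real.log (√(Q a) / √(P a)) := by
        rw [Real.log_div hq.ne' hp.ne', Real.log_sqrt h1.le, Real.log_sqrt h0.le,
          Real.log_div h0.ne' h1.ne']
        ring
      have e2 : P a * (√(Q a) / √(P a)) = √(P a) * √(Q a) := by
        field_simp
        rw [Real.sq_sqrt h0.le]
      rw [e]
      nlinarith [mul_le_mul_of_nonneg_left hl h0.le]
    rw [hsum _ (by norm_num)]
    have := Finset.sum_le_sum fun a (_ : a ∈ Finset.univ) => h a
    rw [← Finset.mul_sum, Finset.sum_sub_distrib, hP1] at this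
    unfold finiteKL
    linarith
  have hle4 : ∑ a, (√(P a) + 1 * √(Q a)) ^ 2 ≤ 4 := by
    have h0 : 0 ≤ ∑ a, (√(P a) + (-1) * √(Q a)) ^ 2 := Finset.sum_nonneg fun _ _ => sq_nonneg _
    rw [hsum _ (by norm_num)] at h0 ⊢
    linarith
  have hfac (a : α) : |P a - Q a| = |√(P a) + (-1) * √(Q a)| * |√(P a) + 1 * √(Q a)| := by
    rw [← abs_mul]
    congr 1
    linear_combination -Real.sq_sqrt (hP a) + Real.sq_sqrt (hQ a)
  have hcs := Finset.sum_mul_sq_le_sq_mul_sq Finset.univ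
    (fun a => |√(P a) + (-1) * √(Q a)|) (fun a => |√(P a) + 1 * √(Q a)|)
  simp only [sq_abs] at hcs
  simp_rw [hfac]
  have h0 : 0 ≤ ∑ a, (√(P a) + (-1) * √(Q a)) ^ 2 := Finset.sum_nonneg fun _ _ => sq_nonneg _
  nlinarith [mul_le_mul_of_nonneg_left hle4 h0]

/-- The chain rule for the Kullback-Leibler divergence. -/
theorem finiteKL_prod {α β : Type*} [Fintype α] [Fintype β] {P P' : α → ℝ} {q q' : α → β → ℝ}
    (hP : ∀ a, 0 ≤ P a) (hq : ∀ a b, 0 ≤ q a b) (hPP' : ∀ a, 0 < P a → 0 < P' a)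
    (hqq' : ∀ a b, 0 < q a b → 0 < q' a b) (hq1 : ∀ a, ∑ b, q a b = 1) :
    finiteKL (fun z : α × β => P z.1 * q z.1 z.2) (fun z => P' z.1 * q' z.1 z.2)
      = finiteKL P P' + ∑ a, P a * finiteKL (q a) (q' a) := by
  unfold finiteKL
  rw [Fintype.sum_prod_type, ← Finset.sum_add_distrib]
  refine Finset.sum_congr rfl fun a _ => ?_
  have h (b : β) : P a * q a b * Real.log (P a * q a b / (P' a * q' a b))
      = P a * Real.log (P a / P' a) * q a b + P a * (q a b * Real.log (q a b / q' a b)) := by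
    rcases (hP a).eq_or_lt with h0 | h0
    · simp [← h0]
    rcases (hq a b).eq_or_lt with h1 | h1
    · simp [← h1]
    have h2 := hPP' a h0
    have h3 := hqq' a b h1
    rw [mul_div_mul_comm, Real.log_mul (by positivity) (by positivity)]
    ring
  simp_rw [h, Finset.sum_add_distrib, ← Finset.mul_sum, hq1, mul_one]

/-- The entropy of a mass function is at most the logarithm of the number of its values. -/
theorem sum_mul_log_inv_le_log_card {α : Type*} [Fintype α] {P : α → ℝ}
    (hP : ∀ a, 0 ≤ P a) (hP1 : ∑ a, P a = 1) :
    ∑ a, P a * Real.log (P a)⁻¹ ≤ Real.log (Fintype.card α) := by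
  have hne : Nonempty α := by
    by_contra h
    rw [not_nonempty_iff] at h
    simp at hP1
  have hN : (0 : ℝ) < Fintype.card α := by exact_mod_cast Fintype.card_pos
  have h (a : α) : P a * Real.log (P a)⁻¹
      ≤ P a * Real.log (Fintype.card α) + ((Fintype.card α : ℝ)⁻¹ - P a) := by
    rcases (hP a).eq_or_lt with h0 | h0
    · rw [← h0]; simp
    have hl := Real.log_le_sub_one_of_pos (show 0 < (P a)⁻¹ / Fintype.card α by positivity)
    rw [Real.log_div (by positivity) hN.ne'] at hl
    have e : P a * ((P a)⁻¹ / Fintype.card α) = (Fintype.card α : ℝ)⁻¹ := by field_simp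
    nlinarith [mul_le_mul_of_nonneg_left hl h0.le]
  refine (Finset.sum_le_sum fun a _ => h a).trans_eq ?_
  rw [Finset.sum_add_distrib, Finset.sum_sub_distrib, ← Finset.sum_mul, hP1, Finset.sum_const,
    Finset.card_univ, nsmul_eq_mul, mul_inv_cancel₀ hN.ne']
  ring

/-! ### Biased random sign vectors -/

/-- The sign coded by a Boolean. -/
def sgn (b : Bool) : ℝ := if b then 1 else -1

theorem sgn_not (b : Bool) : sgn (!b) = -sgn b := by cases b <;> simp [sgn]

theorem abs_sgn (b : Bool) : |sgn b| = 1 := by cases b <;> simp [sgn]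

theorem sgn_mul_self (b : Bool) : sgn b * sgn b = 1 := by cases b <;> simp [sgn]

theorem sgn_mul_sgn (a b : Bool) : sgn a * sgn b = 1 ∨ sgn a * sgn b = -1 := by
  cases a <;> cases b <;> simp [sgn]

section Signs

variable {d : ℕ} {ε : ℝ}

/-- The probability of the sign vector `s` when its coordinates are independent and coordinate `i`
has mean `ε * sgn (v i)`. -/
noncomputable def signProb (ε : ℝ) (v s : Fin d → Bool) : ℝ :=
  ∏ i, (1 + ε * (sgn (v i) * sgn (s i))) / 2

/-- The vector `v` with its coordinate `i` negated. -/
def flip (i : Fin d) (v : Fin d → Bool) : Fin d → Bool := Function.update v i (!v i)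

theorem flip_involutive (i : Fin d) : Function.Involutive (flip i) := fun v => by simp [flip]

/-- The relative change of `signProb ε v s` when coordinate `i` of `v` is negated, as a function of
`a = v i` and `b = s i`. -/
noncomputable def tilt (ε : ℝ) (a b : Bool) : ℝ :=
  -(2 * ε * (sgn a * sgn b)) / (1 + ε * (sgn a * sgn b))

theorem weight_pos (hε : 0 ≤ ε) (hε' : ε ≤ 1 / 4) (a b : Bool) :
    0 < 1 + ε * (sgn a * sgn b) := by
  rcases sgn_mul_sgn a b with h | h <;> rw [h] <;> linarith

theorem abs_tilt_le (hε : 0 ≤ ε) (hε' : ε ≤ 1 / 4) (a b : Bool) : |tilt ε a b| ≤ 8 / 3 * ε := by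
  have h := weight_pos hε hε' a b
  rw [tilt, abs_div, abs_of_pos h, div_le_iff₀ h, abs_le]
  rcases sgn_mul_sgn a b with h | h <;> rw [h] <;> constructor <;> nlinarith

theorem le_one_add_tilt (hε : 0 ≤ ε) (hε' : ε ≤ 1 / 4) (a b : Bool) : 3 / 5 ≤ 1 + tilt ε a b := by
  have h := weight_pos hε hε' a b
  rw [tilt, one_add_div h.ne', le_div_iff₀ h]
  rcases sgn_mul_sgn a b with h | h <;> rw [h] <;> nlinarith

theorem weight_mul_tilt (hε : 0 ≤ ε) (hε' : ε ≤ 1 / 4) (a b : Bool) :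
    (1 + ε * (sgn a * sgn b)) * tilt ε a b = -(2 * ε * (sgn a * sgn b)) :=
  mul_div_cancel₀ _ (weight_pos hε hε' a b).ne'

theorem signProb_pos (hε : 0 ≤ ε) (hε' : ε ≤ 1 / 4) (v s : Fin d → Bool) : 0 < signProb ε v s :=
  Finset.prod_pos fun i _ => half_pos (weight_pos hε hε' (v i) (s i))

theorem signProb_flip (hε : 0 ≤ ε) (hε' : ε ≤ 1 / 4) (i : Fin d) (v s : Fin d → Bool) :
    signProb ε (flip i v) s = signProb ε v s * (1 + tilt ε (v i) (s i)) := by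
  unfold signProb
  rw [← Finset.mul_prod_erase _ _ (Finset.mem_univ i),
    ← Finset.mul_prod_erase _ (fun j => (1 + ε * (sgn (v j) * sgn (s j))) / 2) (Finset.mem_univ i)]
  have h : ∏ j ∈ Finset.univ.erase i, (1 + ε * (sgn (flip i v j) * sgn (s j))) / 2
      = ∏ j ∈ Finset.univ.erase i, (1 + ε * (sgn (v j) * sgn (s j))) / 2 := by
    refine Finset.prod_congr rfl fun j hj => ?_
    rw [flip, Function.update_of_ne (Finset.ne_of_mem_erase hj)]
  rw [h, flip, Function.update_self, sgn_not]
  linear_combination (-(1 / 2) * ∏ j ∈ Finset.univ.erase i, (1 + ε * (sgn (v j) * sgn (s j))) / 2) *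
    weight_mul_tilt hε hε' (v i) (s i)

/-- Under `signProb ε v` the coordinates are independent. -/
theorem sum_signProb_mul_prod (ε : ℝ) (v : Fin d → Bool) (g : Fin d → Bool → ℝ) :
    ∑ s, signProb ε v s * ∏ i, g i (s i)
      = ∏ i, ∑ b, (1 + ε * (sgn (v i) * sgn b)) / 2 * g i b := by
  rw [Finset.prod_univ_sum, Fintype.piFinset_univ]
  simp_rw [signProb, ← Finset.prod_mul_distrib]

theorem sum_weight (ε : ℝ) (a : Bool) : ∑ b, (1 + ε * (sgn a * sgn b)) / 2 = 1 := by
  simp [sgn]; ring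

theorem sum_signProb (ε : ℝ) (v : Fin d → Bool) : ∑ s, signProb ε v s = 1 := by
  simpa only [Finset.prod_const_one, mul_one, sum_weight]
    using sum_signProb_mul_prod ε v fun _ _ => 1

theorem sum_signProb_mul_sgn (ε : ℝ) (v : Fin d → Bool) (i : Fin d) :
    ∑ s, signProb ε v s * sgn (s i) = ε * sgn (v i) := by
  have h := sum_signProb_mul_prod ε v fun j b => if j = i then sgn b else 1
  simp only [Finset.prod_ite_eq', Finset.mem_univ, if_true] at h
  rw [h, Finset.prod_eq_single i]
  · simp [sgn]; split_ifs <;> ring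
  · intro j _ hj
    simp only [if_neg hj, mul_one, sum_weight]
  · simp

/-- An inequality that bounds the moment generating function of a bounded centred variable. -/
theorem exp_le_add_exp_sq (x : ℝ) : Real.exp x ≤ x + Real.exp (x ^ 2) := by
  have h1 := Real.add_one_le_exp (x ^ 2)
  rcases le_or_gt |x| 1 with h | h
  · have := (abs_le.1 (Real.abs_exp_sub_one_sub_id_le h)).2
    linarith
  · rcases lt_abs.1 h with h | h
    · have := Real.exp_le_exp.2 (show x ≤ x ^ 2 by nlinarith)
      linarith
    · have := Real.exp_le_one_iff.2 (show x ≤ 0 by linarith)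
      nlinarith

/-- One tilt is centred and bounded, hence subgaussian. -/
theorem sum_weight_mul_exp_tilt_le (hε : 0 ≤ ε) (hε' : ε ≤ 1 / 4) (a : Bool) (t : ℝ) :
    ∑ b, (1 + ε * (sgn a * sgn b)) / 2 * Real.exp (t * tilt ε a b)
      ≤ Real.exp (t ^ 2 * (8 / 3 * ε) ^ 2) := by
  have hmean : ∑ b, (1 + ε * (sgn a * sgn b)) / 2 * (t * tilt ε a b) = 0 := by
    have h (b : Bool) : (1 + ε * (sgn a * sgn b)) / 2 * (t * tilt ε a b)
        = -t * ε * (sgn a * sgn b) := by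
      linear_combination t / 2 * weight_mul_tilt hε hε' a b
    simp_rw [h]
    simp [sgn]
  have hb (b : Bool) : (1 + ε * (sgn a * sgn b)) / 2 * Real.exp (t * tilt ε a b)
      ≤ (1 + ε * (sgn a * sgn b)) / 2 * (t * tilt ε a b)
        + (1 + ε * (sgn a * sgn b)) / 2 * Real.exp (t ^ 2 * (8 / 3 * ε) ^ 2) := by
    rw [← mul_add]
    refine mul_le_mul_of_nonneg_left ((exp_le_add_exp_sq _).trans ?_)
      (half_pos (weight_pos hε hε' a b)).le
    gcongr
    rw [mul_pow]
    gcongr ?_ * ?_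
    rw [← sq_abs]
    gcongr
    exact abs_tilt_le hε hε' a b
  refine (Finset.sum_le_sum fun b _ => hb b).trans_eq ?_
  rw [Finset.sum_add_distrib, hmean, ← Finset.sum_mul, sum_weight, zero_add, one_mul]

/-! ### The information carried by one channel output -/

/-- The probability under `signProb ε v` of an output which has probability `W s` given `s`. -/
noncomputable def outProb (ε : ℝ) (v : Fin d → Bool) (W : (Fin d → Bool) → ℝ) : ℝ :=
  ∑ s, signProb ε v s * W s

/-- The relative change of `outProb ε v W` when coordinate `i` of `v` is negated. -/
noncomputable def outTilt (ε : ℝ) (v : Fin d → Bool) (W : (Fin d → Bool) → ℝ) (i : Fin d) : ℝ :=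
  (∑ s, signProb ε v s * W s * tilt ε (v i) (s i)) / outProb ε v W

variable {W : (Fin d → Bool) → ℝ}

theorem outProb_nonneg (hε : 0 ≤ ε) (hε' : ε ≤ 1 / 4) (hW : ∀ s, 0 ≤ W s) (v : Fin d → Bool) :
    0 ≤ outProb ε v W :=
  Finset.sum_nonneg fun s _ => mul_nonneg (signProb_pos hε hε' v s).le (hW s)

theorem outProb_flip (hε : 0 ≤ ε) (hε' : ε ≤ 1 / 4) (v : Fin d → Bool) (i : Fin d) :
    outProb ε (flip i v) W
      = outProb ε v W + ∑ s, signProb ε v s * W s * tilt ε (v i) (s i) := by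
  simp_rw [outProb, signProb_flip hε hε', ← Finset.sum_add_distrib]
  exact Finset.sum_congr rfl fun s _ => by ring

theorem outProb_flip_of_pos (hε : 0 ≤ ε) (hε' : ε ≤ 1 / 4) {v : Fin d → Bool}
    (h : 0 < outProb ε v W) (i : Fin d) :
    outProb ε (flip i v) W = outProb ε v W * (1 + outTilt ε v W i) := by
  rw [outProb_flip hε hε', outTilt]
  field_simp

theorem le_outProb_flip (hε : 0 ≤ ε) (hε' : ε ≤ 1 / 4) (hW : ∀ s, 0 ≤ W s) (v : Fin d → Bool)
    (i : Fin d) : 3 / 5 * outProb ε v W ≤ outProb ε (flip i v) W := by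
  simp_rw [outProb, signProb_flip hε hε', Finset.mul_sum]
  refine Finset.sum_le_sum fun s _ => ?_
  have := mul_nonneg (signProb_pos hε hε' v s).le (hW s)
  nlinarith [mul_le_mul_of_nonneg_left (le_one_add_tilt hε hε' (v i) (s i)) this]

theorem abs_outTilt_le (hε : 0 ≤ ε) (hε' : ε ≤ 1 / 4) (hW : ∀ s, 0 ≤ W s) {v : Fin d → Bool}
    (h : 0 < outProb ε v W) (i : Fin d) : |outTilt ε v W i| ≤ 8 / 3 * ε := by
  rw [outTilt, abs_div, abs_of_pos h, div_le_iff₀ h, outProb, Finset.mul_sum]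
  refine (Finset.abs_sum_le_sum_abs _ _).trans (Finset.sum_le_sum fun s _ => ?_)
  have := mul_nonneg (signProb_pos hε hε' v s).le (hW s)
  rw [abs_mul, abs_of_nonneg this, mul_comm]
  exact mul_le_mul_of_nonneg_right (abs_tilt_le hε hε' _ _) this

/-- An output of probability `P` reveals at most of order `ε ^ 2 * log (1 / P)` about all coordinates
of `v` together: this is the Gibbs variational principle for a subgaussian sum. -/
theorem sum_sq_outTilt_le (hε : 0 < ε) (hε' : ε ≤ 1 / 4) (hW : ∀ s, 0 ≤ W s) (hW1 : ∀ s, W s ≤ 1)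
    {v : Fin d → Bool} (h : 0 < outProb ε v W) :
    ∑ i, outTilt ε v W i ^ 2 ≤ 4 * (8 / 3 * ε) ^ 2 * Real.log (outProb ε v W)⁻¹ := by
  set P := outProb ε v W
  set k : Fin d → ℝ := outTilt ε v W
  set M : ℝ := 8 / 3 * ε with hM
  have hMpos : 0 < M := by positivity
  -- the optimal exponent in the moment generating function
  set c : ℝ := 1 / (2 * M ^ 2) with hc
  set Z : (Fin d → Bool) → ℝ := fun s => ∑ i, c * k i * tilt ε (v i) (s i) with hZ
  have hw0 (s) : 0 ≤ signProb ε v s * W s / P :=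
    div_nonneg (mul_nonneg (signProb_pos hε.le hε' v s).le (hW s)) h.le
  have hw1 : ∑ s, signProb ε v s * W s / P = 1 := by
    rw [← Finset.sum_div]; exact div_self h.ne'
  -- Jensen's inequality for the conditional law of `s` given the output
  have hjensen := convexOn_exp.map_sum_le (t := Finset.univ) (fun s _ => hw0 s) hw1
    (fun s _ => Set.mem_univ (Z s))
  simp only [smul_eq_mul] at hjensen
  have hmean : ∑ s, signProb ε v s * W s / P * Z s = c * ∑ i, k i ^ 2 := by
    simp_rw [hZ, Finset.mul_sum]
    rw [Finset.sum_comm]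
    refine Finset.sum_congr rfl fun i _ => ?_
    have hki : k i = ∑ s, signProb ε v s * W s * tilt ε (v i) (s i) / P := Finset.sum_div _ _ _
    rw [sq]
    nth_rw 2 [hki]
    rw [Finset.sum_mul, Finset.mul_sum]
    exact Finset.sum_congr rfl fun s _ => by ring
  have hmgf : ∑ s, signProb ε v s * W s / P * Real.exp (Z s)
      ≤ P⁻¹ * Real.exp (c ^ 2 * M ^ 2 * ∑ i, k i ^ 2) := by
    calc ∑ s, signProb ε v s * W s / P * Real.exp (Z s)
        ≤ ∑ s, P⁻¹ * (signProb ε v s * Real.exp (Z s)) := by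
          refine Finset.sum_le_sum fun s _ => ?_
          have h1 : 0 ≤ P⁻¹ * (signProb ε v s * Real.exp (Z s)) :=
            mul_nonneg (inv_nonneg.2 h.le)
              (mul_nonneg (signProb_pos hε.le hε' v s).le (Real.exp_pos _).le)
          calc _ = P⁻¹ * (signProb ε v s * Real.exp (Z s)) * W s := by ring
            _ ≤ _ := mul_le_of_le_one_right h1 (hW1 s)
      _ = P⁻¹ * ∏ i, ∑ b, (1 + ε * (sgn (v i) * sgn b)) / 2
            * Real.exp (c * k i * tilt ε (v i) b) := by
          rw [← Finset.mul_sum, ← sum_signProb_mul_prod]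
          simp_rw [hZ, Real.exp_sum]
      _ ≤ P⁻¹ * ∏ i, Real.exp ((c * k i) ^ 2 * M ^ 2) := by
          refine mul_le_mul_of_nonneg_left (Finset.prod_le_prod (fun i _ => ?_) fun i _ =>
            sum_weight_mul_exp_tilt_le hε.le hε' _ _) (inv_nonneg.2 h.le)
          exact Finset.sum_nonneg fun b _ =>
            mul_nonneg (half_pos (weight_pos hε.le hε' _ _)).le (Real.exp_pos _).le
      _ = P⁻¹ * Real.exp (c ^ 2 * M ^ 2 * ∑ i, k i ^ 2) := by
          rw [← Real.exp_sum, Finset.mul_sum]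
          congr 2
          exact Finset.sum_congr rfl fun i _ => by ring
  rw [hmean] at hjensen
  have hlog := Real.log_le_log (Real.exp_pos _) (hjensen.trans hmgf)
  rw [Real.log_exp, Real.log_mul (inv_ne_zero h.ne') (Real.exp_pos _).ne', Real.log_exp] at hlog
  have e1 : c ^ 2 * M ^ 2 = c / 2 := by rw [hc]; field_simp
  rw [e1] at hlog
  have e2 : 4 * M ^ 2 * (c / 2 * ∑ i, k i ^ 2) = ∑ i, k i ^ 2 := by rw [hc]; field_simp; norm_num
  rw [← e2]
  exact mul_le_mul_of_nonneg_left (by linarith) (by positivity)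

/-- The information about the coordinates of `v` that is carried by one output of a channel with
values in a set of `2 ^ r` elements: it is at most of order `ε ^ 2 * d`, as without a channel, and
at most of order `ε ^ 2` times the entropy of the output, which is `r` bits or less. -/
theorem sum_finiteKL_outProb_le {Y : Type*} [Fintype Y] {r : ℕ} (hY : Fintype.card Y = 2 ^ r)
    (hε : 0 < ε) (hε' : ε ≤ 1 / 4) {K : Y → (Fin d → Bool) → ℝ} (hK : ∀ z s, 0 ≤ K z s)
    (hK1 : ∀ s, ∑ z, K z s = 1) (v : Fin d → Bool) :
    ∑ i, finiteKL (fun z => outProb ε v (K z)) (fun z => outProb ε (flip i v) (K z))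
      ≤ 36 * ε ^ 2 * (min d r : ℕ) := by
  set P : Y → ℝ := fun z => outProb ε v (K z) with hP
  have hP0 (z) : 0 ≤ P z := outProb_nonneg hε.le hε' (hK z) v
  have hsum (v : Fin d → Bool) : ∑ z, outProb ε v (K z) = 1 := by
    simp_rw [outProb]
    rw [Finset.sum_comm]
    simp_rw [← Finset.mul_sum, hK1, mul_one, sum_signProb]
  have hKle (z s) : K z s ≤ 1 :=
    (Finset.single_le_sum (fun z _ => hK z s) (Finset.mem_univ z)).trans_eq (hK1 s)
  have hi (i : Fin d) : finiteKL P (fun z => outProb ε (flip i v) (K z))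
      ≤ 5 / 3 * ∑ z, P z * outTilt ε v (K z) i ^ 2 := by
    -- `-log (1 + x) ≤ -x + x ^ 2 / (1 + x)`, where the linear terms cancel in the sum over `z`
    have hz (z : Y) : P z * Real.log (P z / outProb ε (flip i v) (K z))
        ≤ P z - outProb ε (flip i v) (K z) + 5 / 3 * (P z * outTilt ε v (K z) i ^ 2) := by
      rcases (hP0 z).eq_or_lt with h0 | h0
      · have h1 : outProb ε (flip i v) (K z) ≤ 0 := by
          have := le_outProb_flip hε.le hε' (hK z) (flip i v) i
          rw [flip_involutive i v] at this
          change 3 / 5 * _ ≤ P z at this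
          linarith
        rw [← h0]
        linarith [outProb_nonneg hε.le hε' (hK z) (flip i v)]
      have hfl := outProb_flip_of_pos hε.le hε' h0 i
      change outProb ε (flip i v) (K z) = P z * (1 + outTilt ε v (K z) i) at hfl
      have hge : 3 / 5 * P z ≤ outProb ε (flip i v) (K z) := le_outProb_flip hε.le hε' (hK z) v i
      rw [hfl] at hge ⊢
      set x := outTilt ε v (K z) i
      have hx : 3 / 5 ≤ 1 + x := by nlinarith
      have hl := Real.log_le_sub_one_of_pos (show 0 < P z / (P z * (1 + x)) by positivity)
      have e : P z / (P z * (1 + x)) - 1 = -x + x ^ 2 / (1 + x) := by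
        have : 1 + x ≠ 0 := by linarith
        field_simp; ring
      have hx2 : x ^ 2 / (1 + x) ≤ 5 / 3 * x ^ 2 := by
        rw [div_le_iff₀ (by linarith)]
        nlinarith [mul_le_mul_of_nonneg_left hx (sq_nonneg x)]
      rw [e] at hl
      nlinarith [mul_le_mul_of_nonneg_left (hl.trans (add_le_add_right hx2 (-x))) h0.le]
    refine (Finset.sum_le_sum fun z _ => hz z).trans_eq ?_
    rw [Finset.sum_add_distrib, Finset.sum_sub_distrib, hsum, hsum, sub_self, zero_add,
      ← Finset.mul_sum]
  have hall : ∑ i, finiteKL P (fun z => outProb ε (flip i v) (K z))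
      ≤ 5 / 3 * ∑ z, P z * ∑ i, outTilt ε v (K z) i ^ 2 := by
    refine (Finset.sum_le_sum fun i _ => hi i).trans_eq ?_
    rw [← Finset.mul_sum, Finset.sum_comm]
    simp_rw [Finset.mul_sum]
  refine hall.trans ?_
  rcases le_total d r with hdr | hdr
  -- if `d ≤ r`, each relative change is bounded by itself; otherwise the entropy bound is better
  · rw [min_eq_left hdr]
    have hz (z : Y) : P z * ∑ i, outTilt ε v (K z) i ^ 2 ≤ P z * (d * (8 / 3 * ε) ^ 2) := by
      rcases (hP0 z).eq_or_lt with h0 | h0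
      · rw [← h0]; simp
      refine mul_le_mul_of_nonneg_left ?_ h0.le
      calc ∑ i, outTilt ε v (K z) i ^ 2 ≤ ∑ i : Fin d, (8 / 3 * ε) ^ 2 := by
            refine Finset.sum_le_sum fun i _ => ?_
            rw [← sq_abs]
            exact pow_le_pow_left₀ (abs_nonneg _) (abs_outTilt_le hε.le hε' (hK z) h0 i) 2
        _ = _ := by simp
    have := Finset.sum_le_sum fun z (_ : z ∈ Finset.univ) => hz z
    rw [← Finset.sum_mul, hsum, one_mul] at this
    have h0 : 0 ≤ ε ^ 2 * d := by positivity
    nlinarith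
  · rw [min_eq_right hdr]
    have hz (z : Y) : P z * ∑ i, outTilt ε v (K z) i ^ 2
        ≤ 4 * (8 / 3 * ε) ^ 2 * (P z * Real.log (P z)⁻¹) := by
      rcases (hP0 z).eq_or_lt with h0 | h0
      · rw [← h0]; simp
      have := mul_le_mul_of_nonneg_left (sum_sq_outTilt_le hε hε' (hK z) (hKle z) h0) h0.le
      calc _ ≤ _ := this
        _ = _ := by simp only [hP]; ring
    have h1 := Finset.sum_le_sum fun z (_ : z ∈ Finset.univ) => hz z
    have h2 := sum_mul_log_inv_le_log_card hP0 (hsum v)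
    rw [← Finset.mul_sum] at h1
    rw [hY] at h2
    push_cast at h2
    rw [Real.log_pow] at h2
    have h3 := Real.log_two_lt_d9
    have h4 : (r : ℝ) * Real.log 2 ≤ r * (0.6931471808 : ℝ) := by gcongr
    have h5 := mul_le_mul_of_nonneg_left (h2.trans h4) (show 0 ≤ 4 * (8 / 3 * ε) ^ 2 by positivity)
    have h0 : 0 ≤ ε ^ 2 * r := by positivity
    nlinarith

end Signs

/-! ### Averaging over sign vectors -/

/-- The averaging argument of Assouad's lemma: an estimate `x` of the sign vector `-v` whose law
hardly changes when one coordinate of `v` is negated has a large `ℓ_1` error for an average `v`. -/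
theorem le_sum_signs_sum_error {d : ℕ} {α : Type*} [Fintype α] {P : (Fin d → Bool) → α → ℝ}
    (hP1 : ∀ v, ∑ y, P v y = 1) {a l : ℝ} {x : α → Fin d → ℝ} (hx : ∀ y i, |x y i| ≤ a)
    (hl : ∀ v, ∑ i, ∑ y, |P v y - P (flip i v) y| ≤ l) (ha : 0 ≤ a) :
    2 ^ d * (a * (d - l / 2)) ≤ ∑ v, ∑ y, P v y * ∑ i, (a + sgn (v i) * x y i) := by
  have hexpand (v : Fin d → Bool) : ∑ y, P v y * ∑ i, (a + sgn (v i) * x y i)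
      = d * a + ∑ i, sgn (v i) * ∑ y, P v y * x y i := by
    simp_rw [Finset.sum_add_distrib, mul_add, Finset.sum_add_distrib, ← Finset.sum_mul, hP1,
      Finset.sum_const, Finset.card_univ, Fintype.card_fin, nsmul_eq_mul, one_mul, Finset.mul_sum]
    rw [Finset.sum_comm]
    congr 1
    exact Finset.sum_congr rfl fun i _ => Finset.sum_congr rfl fun y _ => by ring
  have hi (i : Fin d) : -(a / 2) * ∑ v, ∑ y, |P v y - P (flip i v) y|
      ≤ ∑ v, sgn (v i) * ∑ y, P v y * x y i := by
    have hflip : ∑ v, sgn (v i) * ∑ y, P v y * x y i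
        = ∑ v, -(sgn (v i) * ∑ y, P (flip i v) y * x y i) := by
      rw [← Equiv.sum_comp (Function.Involutive.toPerm (flip i) (flip_involutive i))]
      refine Finset.sum_congr rfl fun v _ => ?_
      rw [Function.Involutive.coe_toPerm, ← neg_mul]
      congr 1
      rw [flip, Function.update_self, sgn_not]
    have hdiff : 2 * ∑ v, sgn (v i) * ∑ y, P v y * x y i
        = ∑ v, ∑ y, sgn (v i) * x y i * (P v y - P (flip i v) y) := by
      rw [two_mul]
      conv_lhs => rw [hflip]; enter [2]; rw [← hflip]
      rw [← Finset.sum_add_distrib]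
      refine Finset.sum_congr rfl fun v _ => ?_
      rw [Finset.mul_sum, Finset.mul_sum, ← Finset.sum_neg_distrib, ← Finset.sum_add_distrib]
      exact Finset.sum_congr rfl fun y _ => by ring
    have hge : ∑ v, ∑ y, -(a * |P v y - P (flip i v) y|)
        ≤ ∑ v, ∑ y, sgn (v i) * x y i * (P v y - P (flip i v) y) := by
      refine Finset.sum_le_sum fun v _ => Finset.sum_le_sum fun y _ => ?_
      refine (neg_le_neg ?_).trans (neg_abs_le _)
      rw [abs_mul, abs_mul, abs_sgn, one_mul]
      exact mul_le_mul_of_nonneg_right (hx y i) (abs_nonneg _)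
    rw [← hdiff] at hge
    simp_rw [Finset.sum_neg_distrib, ← Finset.mul_sum] at hge
    linarith
  simp_rw [hexpand]
  rw [Finset.sum_add_distrib, Finset.sum_comm]
  have h1 := Finset.sum_le_sum fun i (_ : i ∈ Finset.univ) => hi i
  rw [← Finset.mul_sum, Finset.sum_comm] at h1
  have h2 := Finset.sum_le_sum fun v (_ : v ∈ Finset.univ) => hl v
  simp only [Finset.sum_const, Finset.card_univ, Fintype.card_pi, Fintype.card_bool,
    Finset.prod_const, Fintype.card_fin, nsmul_eq_mul] at h2 ⊢
  push_cast at h2 ⊢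
  nlinarith [mul_le_mul_of_nonneg_left h2 (div_nonneg ha zero_le_two)]

/-! ### The hard instances -/

section Instances

variable {d : ℕ} {X : Set (Fin d → ℝ)} {ε b : ℝ}

/-- The vector with entries `±b` and the signs `s`. -/
def signPoint (b : ℝ) (s : Fin d → Bool) : Fin d → ℝ := fun i => b * sgn (s i)

/-- The law of a random vector with independent entries `±b` and the mean `b * ε * sgn (v i)` in
coordinate `i`. -/
noncomputable def signMeasure (ε b : ℝ) (v : Fin d → Bool) : Measure (Fin d → ℝ) :=
  ∑ s, ENNReal.ofReal (signProb ε v s) • Measure.dirac (signPoint b s)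

/-- The oracle that answers every query by an independent sample of `signMeasure ε b v`. -/
noncomputable def signOracle (X : Set (Fin d → ℝ)) (ε b : ℝ) (v : Fin d → Bool) :
    Kernel X (Fin d → ℝ) :=
  Kernel.const X (signMeasure ε b v)

/-- The linear function with the gradient that `signOracle X ε b v` estimates. -/
noncomputable def signLoss (ε b : ℝ) (v : Fin d → Bool) (x : Fin d → ℝ) : ℝ :=
  ∑ i, b * ε * (sgn (v i) * x i)

theorem isProbabilityMeasure_signMeasure (hε : 0 ≤ ε) (hε' : ε ≤ 1 / 4) (v : Fin d → Bool) :
    IsProbabilityMeasure (signMeasure ε b v) := by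
  constructor
  simp only [signMeasure, Measure.coe_finsetSum, Finset.sum_apply, Measure.smul_apply,
    measure_univ, smul_eq_mul, mul_one]
  rw [← ENNReal.ofReal_sum_of_nonneg fun s _ => (signProb_pos hε hε' v s).le, sum_signProb,
    ENNReal.ofReal_one]

theorem isMarkovKernel_signOracle (hε : 0 ≤ ε) (hε' : ε ≤ 1 / 4) (v : Fin d → Bool) :
    IsMarkovKernel (signOracle X ε b v) := by
  have := isProbabilityMeasure_signMeasure (b := b) hε hε' v
  unfold signOracle
  infer_instance

theorem integral_signMeasure (hε : 0 ≤ ε) (hε' : ε ≤ 1 / 4) (v : Fin d → Bool) :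
    ∫ g, g ∂(signMeasure ε b v) = fun i => b * ε * sgn (v i) := by
  rw [signMeasure, integral_finsetSum_measure
    fun s _ => (integrable_dirac (by simp)).smul_measure ENNReal.ofReal_ne_top]
  simp_rw [integral_smul_measure, integral_dirac,
    ENNReal.toReal_ofReal (signProb_pos hε hε' v _).le]
  ext i
  simp only [Finset.sum_apply, Pi.smul_apply, smul_eq_mul, signPoint]
  rw [mul_assoc, ← sum_signProb_mul_sgn, Finset.mul_sum]
  exact Finset.sum_congr rfl fun s _ => by ring

theorem ae_signMeasure {q : (Fin d → ℝ) → Prop} (h : ∀ s, q (signPoint b s)) (v : Fin d → Bool) :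
    ∀ᵐ g ∂(signMeasure ε b v), q g := by
  rw [ae_iff, signMeasure]
  simp only [Measure.coe_finsetSum, Finset.sum_apply, Measure.smul_apply, smul_eq_mul]
  refine Finset.sum_eq_zero fun s _ => ?_
  rw [Measure.dirac_apply, Set.indicator_of_notMem (by simpa using h s), mul_zero]

theorem signMeasure_bind_apply {Y : Type*} [MeasurableSpace Y] [MeasurableSingletonClass Y]
    (v : Fin d → Bool) (W : Kernel (Fin d → ℝ) Y) (z : Y) :
    (signMeasure ε b v).bind W {z}
      = ∑ s, ENNReal.ofReal (signProb ε v s) * W (signPoint b s) {z} := by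
  rw [Measure.bind_apply (measurableSet_singleton _) W.aemeasurable, signMeasure,
    lintegral_finsetSum_measure]
  simp_rw [lintegral_smul_measure,
    lintegral_dirac' _ (W.measurable_coe (measurableSet_singleton z)),
    smul_eq_mul]

theorem signMeasure_bind_real {Y : Type*} [MeasurableSpace Y] [MeasurableSingletonClass Y]
    (hε : 0 ≤ ε) (hε' : ε ≤ 1 / 4) (v : Fin d → Bool)
    (W : Kernel (Fin d → ℝ) Y) [IsMarkovKernel W] (z : Y) :
    ((signMeasure ε b v).bind W).real {z}
      = outProb ε v fun s => (W (signPoint b s)).real {z} := by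
  rw [Measure.real, signMeasure_bind_apply, ENNReal.toReal_sum fun s _ =>
    ENNReal.mul_ne_top ENNReal.ofReal_ne_top (measure_ne_top _ _)]
  simp_rw [ENNReal.toReal_mul, ENNReal.toReal_ofReal (signProb_pos hε hε' v _).le]
  rfl

end Instances

/-! ### The law of the transcript -/

section Transcript

variable {d T : ℕ} {X : Set (Fin d → ℝ)} {Y Ω : Type} [MeasurableSpace Y] [MeasurableSpace Ω]
  {𝒲 : Set (Kernel (Fin d → ℝ) Y)} {ε b : ℝ} [Fintype Y] [MeasurableSingletonClass Y]

theorem transcriptLaw_succ_singleton (π : Algorithm X T Y Ω) (S : ChannelStrategy 𝒲 T Ω)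
    (O : Kernel X (Fin d → ℝ)) (ω : Ω) {t : ℕ} (h : t + 1 ≤ T) (y : Fin (t + 1) → Y) :
    transcriptLaw π S O ω (t + 1) h {y}
      = transcriptLaw π S O ω t (Nat.le_of_succ_le h) {Fin.init y} *
        ((O (π.query ⟨t, h⟩ ω (Fin.init y))).bind (S.channel ⟨t, h⟩ ω (Fin.init y)))
          {y (Fin.last t)} := by
  rw [transcriptLaw,
    Measure.bind_apply (measurableSet_singleton _) Measurable.of_discrete.aemeasurable,
    lintegral_fintype, Finset.sum_eq_single (Fin.init y)]
  · rw [Measure.map_apply Measurable.of_discrete (measurableSet_singleton _), mul_comm]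
    congr 2
    ext z
    simp only [Set.mem_preimage, Set.mem_singleton_iff]
    constructor
    · intro hz; rw [← hz]; simp
    · rintro rfl; simp
  · intro y' _ hy'
    rw [Measure.map_apply Measurable.of_discrete (measurableSet_singleton _)]
    have hempty : (fun z => Fin.snoc (α := fun _ => Y) y' z) ⁻¹' {y} = ∅ := by
      ext z
      simp only [Set.mem_preimage, Set.mem_singleton_iff, Set.mem_empty_iff_false, iff_false]
      rintro rfl
      simp at hy'
    rw [hempty, measure_empty, zero_mul]
  · simp

theorem isProbabilityMeasure_bind_kernel {α β : Type*} [MeasurableSpace α] [MeasurableSpace β]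
    (μ : Measure α) [IsProbabilityMeasure μ] (κ : Kernel α β) [IsMarkovKernel κ] :
    IsProbabilityMeasure (μ.bind κ) :=
  ⟨by rw [Measure.bind_apply .univ κ.aemeasurable]; simp⟩

theorem isProbabilityMeasure_transcriptLaw (π : Algorithm X T Y Ω) (S : ChannelStrategy 𝒲 T Ω)
    (h𝒲 : ∀ W ∈ 𝒲, IsMarkovKernel W) (O : Kernel X (Fin d → ℝ)) [IsMarkovKernel O] (ω : Ω)
    (t : ℕ) (h : t ≤ T) : IsProbabilityMeasure (transcriptLaw π S O ω t h) := by
  induction t with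
  | zero => rw [transcriptLaw]; infer_instance
  | succ t ih =>
    have := ih (Nat.le_of_succ_le h)
    constructor
    rw [transcriptLaw, Measure.bind_apply .univ Measurable.of_discrete.aemeasurable]
    have hy (y : Fin t → Y) : (((O (π.query ⟨t, h⟩ ω y)).bind fun g =>
        S.channel ⟨t, h⟩ ω y g).map fun z => Fin.snoc (α := fun _ => Y) y z) Set.univ = 1 := by
      have := h𝒲 _ (S.channel_mem ⟨t, h⟩ ω y)
      have := isProbabilityMeasure_bind_kernel (O (π.query ⟨t, h⟩ ω y)) (S.channel ⟨t, h⟩ ω y)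
      rw [Measure.map_apply Measurable.of_discrete .univ, Set.preimage_univ]
      exact measure_univ
    simp_rw [hy]
    simp

/-- The probability of the transcript `y` for the seed `ω` and the oracle `signOracle X ε b v`. -/
noncomputable def transcriptProb (π : Algorithm X T Y Ω) (S : ChannelStrategy 𝒲 T Ω) (ε b : ℝ)
    (ω : Ω) (t : ℕ) (h : t ≤ T) (v : Fin d → Bool) (y : Fin t → Y) : ℝ :=
  (transcriptLaw π S (signOracle X ε b v) ω t h).real {y}

theorem transcriptProb_succ (π : Algorithm X T Y Ω) (S : ChannelStrategy 𝒲 T Ω)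
    (h𝒲 : ∀ W ∈ 𝒲, IsMarkovKernel W) (hε : 0 ≤ ε) (hε' : ε ≤ 1 / 4) (ω : Ω) {t : ℕ}
    (h : t + 1 ≤ T) (v : Fin d → Bool) (y : Fin (t + 1) → Y) :
    transcriptProb π S ε b ω (t + 1) h v y
      = transcriptProb π S ε b ω t (Nat.le_of_succ_le h) v (Fin.init y) *
        outProb ε v fun s =>
          (S.channel ⟨t, h⟩ ω (Fin.init y) (signPoint b s)).real {y (Fin.last t)} := by
  have := h𝒲 _ (S.channel_mem ⟨t, h⟩ ω (Fin.init y))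
  rw [transcriptProb, Measure.real, transcriptLaw_succ_singleton, ENNReal.toReal_mul,
    ← signMeasure_bind_real hε hε']
  rfl

theorem sum_transcriptProb (π : Algorithm X T Y Ω) (S : ChannelStrategy 𝒲 T Ω)
    (h𝒲 : ∀ W ∈ 𝒲, IsMarkovKernel W) (hε : 0 ≤ ε) (hε' : ε ≤ 1 / 4) (ω : Ω) (t : ℕ)
    (h : t ≤ T) (v : Fin d → Bool) : ∑ y, transcriptProb π S ε b ω t h v y = 1 := by
  have := isMarkovKernel_signOracle (X := X) (b := b) hε hε' v
  have := isProbabilityMeasure_transcriptLaw π S h𝒲 (signOracle X ε b v) ω t h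
  simp_rw [transcriptProb]
  rw [sum_measureReal_singleton]
  simp

theorem transcriptProb_flip_pos (π : Algorithm X T Y Ω) (S : ChannelStrategy 𝒲 T Ω)
    (h𝒲 : ∀ W ∈ 𝒲, IsMarkovKernel W) (hε : 0 ≤ ε) (hε' : ε ≤ 1 / 4) (ω : Ω) (t : ℕ)
    (h : t ≤ T) (v : Fin d → Bool) (i : Fin d) (y : Fin t → Y)
    (hy : 0 < transcriptProb π S ε b ω t h v y) :
    0 < transcriptProb π S ε b ω t h (flip i v) y := by
  induction t with
  | zero => exact hy
  | succ t ih =>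
    rw [transcriptProb_succ π S h𝒲 hε hε'] at hy ⊢
    have h2 := fun s => measureReal_nonneg (μ := S.channel ⟨t, h⟩ ω (Fin.init y) (signPoint b s))
      (s := {y (Fin.last t)})
    have h3 := pos_of_mul_pos_left hy (outProb_nonneg hε hε' h2 v)
    have h4 := pos_of_mul_pos_right hy h3.le
    exact mul_pos (ih _ _ h3) (lt_of_lt_of_le (by positivity) (le_outProb_flip hε hε' h2 v i))

/-- The information about all coordinates of `v` in `t` adaptive channel outputs. By the chain rule
it is at most `t` times the bound for one output, since the channel is fixed given the past. -/
theorem sum_finiteKL_transcriptProb_le {r : ℕ} (hY : Fintype.card Y = 2 ^ r)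
    (π : Algorithm X T Y Ω) (S : ChannelStrategy 𝒲 T Ω)
    (h𝒲 : ∀ W ∈ 𝒲, IsMarkovKernel W) (hε : 0 < ε) (hε' : ε ≤ 1 / 4) (ω : Ω) (t : ℕ)
    (h : t ≤ T) (v : Fin d → Bool) :
    ∑ i, finiteKL (transcriptProb π S ε b ω t h v) (transcriptProb π S ε b ω t h (flip i v))
      ≤ t * (36 * ε ^ 2 * (min d r : ℕ)) := by
  induction t with
  | zero =>
    simp [finiteKL, transcriptProb, transcriptLaw]
  | succ t ih =>
    have h' := Nat.le_of_succ_le h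
    set P := transcriptProb π S ε b ω t h' with hP
    set K : (Fin t → Y) → Y → (Fin d → Bool) → ℝ :=
      fun y z s => (S.channel ⟨t, h⟩ ω y (signPoint b s)).real {z} with hK
    have hK1 (y) (s) : ∑ z, K y z s = 1 := by
      have := h𝒲 _ (S.channel_mem ⟨t, h⟩ ω y)
      rw [hK, sum_measureReal_singleton]
      simp
    have hK0 (y z s) : 0 ≤ K y z s := measureReal_nonneg
    have hP0 (y) : 0 ≤ P v y := measureReal_nonneg
    have hout1 (y) : ∑ z, outProb ε v (K y z) = 1 := by
      simp_rw [outProb]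
      rw [Finset.sum_comm]
      simp_rw [← Finset.mul_sum, hK1, mul_one, sum_signProb]
    have hsplit (i : Fin d) : finiteKL (transcriptProb π S ε b ω (t + 1) h v)
        (transcriptProb π S ε b ω (t + 1) h (flip i v))
        = finiteKL (P v) (P (flip i v)) + ∑ y, P v y *
          finiteKL (fun z => outProb ε v (K y z)) (fun z => outProb ε (flip i v) (K y z)) := by
      rw [← finiteKL_prod (fun y => hP0 y)
        (fun y z => outProb_nonneg hε.le hε' (hK0 y z) v)
        (transcriptProb_flip_pos π S h𝒲 hε.le hε' ω t h' v i)
        (fun y z hpos => lt_of_lt_of_le (by positivity) (le_outProb_flip hε.le hε' (hK0 y z) v i))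
        hout1]
      rw [finiteKL, ← Equiv.sum_comp ((Equiv.prodComm _ _).trans (Fin.snocEquiv fun _ => Y))]
      refine Finset.sum_congr rfl fun z _ => ?_
      simp [transcriptProb_succ π S h𝒲 hε.le hε', Fin.snocEquiv, hP, hK]
    simp_rw [hsplit]
    rw [Finset.sum_add_distrib, Finset.sum_comm]
    simp_rw [← Finset.mul_sum]
    have h1 : ∑ y, P v y * ∑ i, finiteKL (fun z => outProb ε v (K y z))
        (fun z => outProb ε (flip i v) (K y z)) ≤ ∑ y, P v y * (36 * ε ^ 2 * (min d r : ℕ)) :=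
      Finset.sum_le_sum fun y _ => mul_le_mul_of_nonneg_left
        (sum_finiteKL_outProb_le hY hε hε' (hK0 y) (hK1 y) v) measureReal_nonneg
    rw [← Finset.sum_mul, sum_transcriptProb π S h𝒲 hε.le hε'] at h1
    have h2 := ih h'
    push_cast at h1 h2 ⊢
    linarith

theorem measurable_transcriptLaw_singleton (π : Algorithm X T Y Ω) (S : ChannelStrategy 𝒲 T Ω)
    (v : Fin d → Bool) (t : ℕ) (h : t ≤ T) (y : Fin t → Y) :
    Measurable fun ω => transcriptLaw π S (signOracle X ε b v) ω t h {y} := by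
  induction t with
  | zero => simp only [transcriptLaw]; exact measurable_const
  | succ t ih =>
    simp_rw [transcriptLaw_succ_singleton, signOracle, Kernel.const_apply, signMeasure_bind_apply]
    refine (ih _ _).mul (Finset.measurable_sum _ fun s _ => Measurable.const_mul ?_ _)
    exact (Measure.measurable_coe (measurableSet_singleton _)).comp
      ((S.measurable_channel ⟨t, h⟩).comp
        (measurable_id.prodMk (measurable_const (a := (Fin.init y, signPoint b s)))))

end Transcript

/-! ### The error of an algorithm on the hard instances -/

theorem ellNorm_le_of_abs_le {d : ℕ} {p : ℝ≥0∞} (hp : 1 ≤ p) {c : ℝ} (hc : 0 ≤ c)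
    {x : Fin d → ℝ} (hx : ∀ i, |x i| ≤ c) : ellNorm p x ≤ (d : ℝ) ^ (1 / p.toReal) * c := by
  unfold ellNorm
  rcases eq_or_ne p ∞ with rfl | hp'
  · rw [PiLp.norm_eq_ciSup]
    simpa using Real.iSup_le hx hc
  · have h0 : 0 < p.toReal := ENNReal.toReal_pos (by positivity) hp'
    rw [PiLp.norm_eq_sum h0]
    calc (∑ i, ‖x i‖ ^ p.toReal) ^ (1 / p.toReal)
        ≤ (∑ i : Fin d, c ^ p.toReal) ^ (1 / p.toReal) := by
          gcongr with i
          exact hx i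
      _ = (d : ℝ) ^ (1 / p.toReal) * c := by
          rw [Finset.sum_const, Finset.card_univ, Fintype.card_fin, nsmul_eq_mul,
            Real.mul_rpow (by positivity) (by positivity), ← Real.rpow_mul hc,
            mul_one_div_cancel h0.ne', Real.rpow_one]

/-- The cube of half-width `a` around the origin: the domain of the hard instances. -/
def cube (d : ℕ) (a : ℝ) : Set (Fin d → ℝ) := {x | ∀ i, |x i| ≤ a}

theorem cube_mem_domains {d : ℕ} {p : ℝ≥0∞} (hp : 1 ≤ p) {a D : ℝ} (ha : 0 ≤ a)
    (h : (d : ℝ) ^ (1 / p.toReal) * (2 * a) ≤ D) : cube d a ∈ domains d p D := by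
  have hpi : cube d a = Set.univ.pi fun _ => Set.Icc (-a) a := by
    ext x
    simp only [cube, abs_le, Set.mem_pi, Set.mem_ofPred_eq, Set.mem_univ, true_imp_iff, Set.mem_Icc]
  refine ⟨⟨0, fun i => by simpa using ha⟩, ?_, ?_, fun x hx y hy => ?_⟩
  · rw [hpi]; exact isClosed_set_pi fun _ _ => isClosed_Icc
  · rw [hpi]; exact convex_pi fun _ _ => convex_Icc _ _
  · refine (ellNorm_le_of_abs_le hp (by positivity) fun i => ?_).trans h
    have := abs_sub (x i) (y i)
    rw [Pi.sub_apply]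
    linarith [hx i, hy i]

theorem signLoss_mem_convexLipschitzFamily {d : ℕ} {p : ℝ≥0∞} {X : Set (Fin d → ℝ)}
    (hX : Convex ℝ X) {ε b B : ℝ} (hε : 0 ≤ ε) (hε' : ε ≤ 1 / 4) (hb : 0 ≤ b)
    (h : (d : ℝ) ^ (1 / p.conjExponent.toReal) * b ≤ B) (v : Fin d → Bool) :
    (signLoss ε b v, signOracle X ε b v) ∈ convexLipschitzFamily p B X := by
  refine ⟨⟨hX, fun x _ y _ s t _ _ _ => le_of_eq ?_⟩, isMarkovKernel_signOracle hε hε' v,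
    fun x => ⟨fun y _ => le_of_eq ?_, ae_signMeasure (fun s => ?_) v⟩⟩
  · simp only [signLoss, Pi.add_apply, Pi.smul_apply, smul_eq_mul, Finset.mul_sum,
      ← Finset.sum_add_distrib]
    exact Finset.sum_congr rfl fun i _ => by ring
  · rw [signOracle, Kernel.const_apply, integral_signMeasure hε hε']
    simp only [signLoss, dotProduct, Pi.sub_apply, ← Finset.sum_add_distrib]
    exact Finset.sum_congr rfl fun i _ => by ring
  · have h0 : 0 ≤ ellNorm p.conjExponent (signPoint b s) := by
      have : Fact (1 ≤ p.conjExponent) := ⟨by simp [ENNReal.conjExponent]⟩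
      exact norm_nonneg _
    refine pow_le_pow_left₀ h0 ((ellNorm_le_of_abs_le (by simp [ENNReal.conjExponent]) hb
      fun i => ?_).trans h) 2
    rw [signPoint, abs_mul, abs_sgn, mul_one, abs_of_nonneg hb]

/-- On the cube the loss exceeds its minimum by the sum of the errors in the coordinates. -/
theorem sum_error_le_signLoss_sub_sInf {d : ℕ} {a ε b : ℝ} (ha : 0 ≤ a) (hc : 0 ≤ b * ε)
    (v : Fin d → Bool) (x : Fin d → ℝ) :
    b * ε * ∑ i, (a + sgn (v i) * x i)
      ≤ signLoss ε b v x - sInf (signLoss ε b v '' cube d a) := by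
  have hmem : (fun i => -(a * sgn (v i))) ∈ cube d a := fun i => by
    rw [abs_neg, abs_mul, abs_sgn, mul_one, abs_of_nonneg ha]
  have hbdd : BddBelow (signLoss ε b v '' cube d a) := by
    refine ⟨∑ i : Fin d, b * ε * -a, ?_⟩
    rintro _ ⟨y, hy, rfl⟩
    refine Finset.sum_le_sum fun i _ => mul_le_mul_of_nonneg_left ?_ hc
    refine (neg_le_neg ?_).trans (neg_abs_le _)
    rw [abs_mul, abs_sgn, one_mul]
    exact hy i
  have h := csInf_le hbdd ⟨_, hmem, rfl⟩
  have e : signLoss ε b v (fun i => -(a * sgn (v i)))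
      = signLoss ε b v x - b * ε * ∑ i, (a + sgn (v i) * x i) := by
    simp only [signLoss, Finset.mul_sum, ← Finset.sum_sub_distrib]
    refine Finset.sum_congr rfl fun i _ => ?_
    linear_combination -(b * ε * a) * sgn_mul_self (v i)
  rw [e] at h
  linarith

section Error

variable {d T r : ℕ} {a ε b : ℝ} {Y Ω : Type} [MeasurableSpace Y] [MeasurableSpace Ω]
  {𝒲 : Set (Kernel (Fin d → ℝ) Y)} [Fintype Y] [MeasurableSingletonClass Y]

/-- If `ε ^ 2 * T * min d r` is small compared with `d`, then `T` adaptive channel outputs do not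
determine a constant fraction of the signs `v`. -/
theorem sum_abs_transcriptProb_sub_le {X : Set (Fin d → ℝ)} (hY : Fintype.card Y = 2 ^ r)
    (π : Algorithm X T Y Ω) (S : ChannelStrategy 𝒲 T Ω)
    (h𝒲 : ∀ W ∈ 𝒲, IsMarkovKernel W) (hε : 0 < ε) (hε' : ε ≤ 1 / 4)
    (hT : ε ^ 2 * (T * (min d r : ℕ)) ≤ d / 100) (ω : Ω) (v : Fin d → Bool) :
    ∑ i, ∑ y, |transcriptProb π S ε b ω T le_rfl v y
      - transcriptProb π S ε b ω T le_rfl (flip i v) y| ≤ 6 / 5 * d := by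
  have hsq : ∑ i, (∑ y, |transcriptProb π S ε b ω T le_rfl v y
      - transcriptProb π S ε b ω T le_rfl (flip i v) y|) ^ 2
      ≤ 4 * (T * (36 * ε ^ 2 * (min d r : ℕ))) := by
    refine (Finset.sum_le_sum fun i _ => sq_sum_abs_sub_le_finiteKL (fun y => measureReal_nonneg)
      (fun y => measureReal_nonneg) (sum_transcriptProb π S h𝒲 hε.le hε' ω T le_rfl v)
      (sum_transcriptProb π S h𝒲 hε.le hε' ω T le_rfl (flip i v))
      (transcriptProb_flip_pos π S h𝒲 hε.le hε' ω T le_rfl v i)).trans ?_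
    rw [← Finset.mul_sum]
    exact mul_le_mul_of_nonneg_left
      (sum_finiteKL_transcriptProb_le hY π S h𝒲 hε hε' ω T le_rfl v) (by norm_num)
  have hcs := sq_sum_le_card_mul_sum_sq (s := Finset.univ) (f := fun i =>
    ∑ y, |transcriptProb π S ε b ω T le_rfl v y
      - transcriptProb π S ε b ω T le_rfl (flip i v) y|)
  rw [Finset.card_univ, Fintype.card_fin] at hcs
  refine abs_le_of_sq_le_sq' ?_ (by positivity) |>.2
  have := mul_le_mul_of_nonneg_left hsq (Nat.cast_nonneg (α := ℝ) d)
  nlinarith [mul_le_mul_of_nonneg_left hT (Nat.cast_nonneg (α := ℝ) d)]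

/-- For every seed, the algorithm makes a large error on an average hard instance. -/
theorem le_sum_lintegral_error (hY : Fintype.card Y = 2 ^ r) (π : Algorithm (cube d a) T Y Ω)
    (S : ChannelStrategy 𝒲 T Ω) (h𝒲 : ∀ W ∈ 𝒲, IsMarkovKernel W) (ha : 0 ≤ a) (hb : 0 ≤ b)
    (hε : 0 < ε) (hε' : ε ≤ 1 / 4) (hT : ε ^ 2 * (T * (min d r : ℕ)) ≤ d / 100) (ω : Ω) :
    2 ^ d * ENNReal.ofReal (2 / 5 * (a * b * d * ε))
      ≤ ∑ v, ∫⁻ y, ENNReal.ofReal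
          (signLoss ε b v (π.output ω y) - sInf (signLoss ε b v '' cube d a))
        ∂(transcriptLaw π S (signOracle (cube d a) ε b v) ω T le_rfl) := by
  have hc : 0 ≤ b * ε := mul_nonneg hb hε.le
  have hassouad := le_sum_signs_sum_error
    (fun v => sum_transcriptProb π S h𝒲 (b := b) hε.le hε' ω T le_rfl v)
    (x := fun y => (π.output ω y : Fin d → ℝ)) (fun y i => (π.output ω y).2 i)
    (sum_abs_transcriptProb_sub_le hY π S h𝒲 hε hε' hT ω) ha
  have hterm (v : Fin d → Bool) (y : Fin T → Y) :
      ENNReal.ofReal (b * ε * (transcriptProb π S ε b ω T le_rfl v y *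
        ∑ i, (a + sgn (v i) * (π.output ω y : Fin d → ℝ) i)))
      ≤ ENNReal.ofReal (signLoss ε b v (π.output ω y) - sInf (signLoss ε b v '' cube d a)) *
        transcriptLaw π S (signOracle (cube d a) ε b v) ω T le_rfl {y} := by
    have := isMarkovKernel_signOracle (X := cube d a) (b := b) hε.le hε' v
    have := isProbabilityMeasure_transcriptLaw π S h𝒲 (signOracle (cube d a) ε b v) ω T le_rfl
    rw [← ofReal_measureReal, ← ENNReal.ofReal_mul' measureReal_nonneg]
    refine ENNReal.ofReal_le_ofReal ?_
    calc _ = b * ε * (∑ i, (a + sgn (v i) * (π.output ω y : Fin d → ℝ) i)) *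
          transcriptProb π S ε b ω T le_rfl v y := by ring
      _ ≤ _ := mul_le_mul_of_nonneg_right (sum_error_le_signLoss_sub_sInf ha hc v _)
          measureReal_nonneg
  have hnn (v : Fin d → Bool) (y : Fin T → Y) : 0 ≤ b * ε * (transcriptProb π S ε b ω T le_rfl v y *
        ∑ i, (a + sgn (v i) * (π.output ω y : Fin d → ℝ) i)) := by
    refine mul_nonneg hc (mul_nonneg measureReal_nonneg (Finset.sum_nonneg fun i _ => ?_))
    have h1 := neg_abs_le (sgn (v i) * (π.output ω y : Fin d → ℝ) i)
    rw [abs_mul, abs_sgn, one_mul] at h1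
    linarith [(π.output ω y).2 i]
  simp_rw [lintegral_fintype]
  refine le_trans ?_ (Finset.sum_le_sum fun v _ => Finset.sum_le_sum fun y _ => hterm v y)
  simp_rw [← ENNReal.ofReal_sum_of_nonneg fun y _ => hnn _ y]
  rw [← ENNReal.ofReal_sum_of_nonneg fun v _ => Finset.sum_nonneg fun y _ => hnn v y]
  have h2 : (2 : ℝ≥0∞) ^ d = ENNReal.ofReal (2 ^ d) := by
    rw [ENNReal.ofReal_pow zero_le_two, ENNReal.ofReal_ofNat]
  rw [h2, ← ENNReal.ofReal_mul (by positivity)]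
  refine ENNReal.ofReal_le_ofReal ?_
  simp_rw [← Finset.mul_sum]
  refine le_trans (le_of_eq ?_) (mul_le_mul_of_nonneg_left hassouad hc)
  ring

theorem measurable_lintegral_error (π : Algorithm (cube d a) T Y Ω) (S : ChannelStrategy 𝒲 T Ω)
    (v : Fin d → Bool) :
    Measurable fun ω => ∫⁻ y, ENNReal.ofReal
        (signLoss ε b v (π.output ω y) - sInf (signLoss ε b v '' cube d a))
      ∂(transcriptLaw π S (signOracle (cube d a) ε b v) ω T le_rfl) := by
  simp_rw [lintegral_fintype]
  refine Finset.measurable_sum _ fun y _ =>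
    Measurable.mul ?_ (measurable_transcriptLaw_singleton π S v T le_rfl y)
  have hout : Measurable fun ω => (π.output ω y : Fin d → ℝ) :=
    measurable_subtype_coe.comp (π.measurable_output.comp (measurable_id.prodMk measurable_const))
  have hloss : Measurable (signLoss ε b v) := by unfold signLoss; fun_prop
  exact ((hloss.comp hout).sub_const _).ennreal_ofReal

/-- For every law of the seed, some hard instance has a large error. -/
theorem le_iSup_optError (hY : Fintype.card Y = 2 ^ r) (μ : Measure Ω) [IsProbabilityMeasure μ]
    (π : Algorithm (cube d a) T Y Ω)
    (S : ChannelStrategy 𝒲 T Ω) (h𝒲 : ∀ W ∈ 𝒲, IsMarkovKernel W) (ha : 0 ≤ a) (hb : 0 ≤ b)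
    (hε : 0 < ε) (hε' : ε ≤ 1 / 4) (hT : ε ^ 2 * (T * (min d r : ℕ)) ≤ d / 100) :
    ENNReal.ofReal (2 / 5 * (a * b * d * ε))
      ≤ ⨆ v, optError μ π S (signLoss ε b v) (signOracle (cube d a) ε b v) := by
  have h1 : 2 ^ d * ENNReal.ofReal (2 / 5 * (a * b * d * ε))
      ≤ ∑ v, optError μ π S (signLoss ε b v) (signOracle (cube d a) ε b v) := by
    simp_rw [optError]
    rw [← lintegral_finsetSum _ fun v _ => measurable_lintegral_error π S v]
    refine le_trans ?_ (lintegral_mono fun ω =>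
      le_sum_lintegral_error hY π S h𝒲 ha hb hε hε' hT ω)
    simp
  have h2 := h1.trans (Finset.sum_le_sum fun v _ =>
    le_iSup (fun v => optError μ π S (signLoss ε b v) (signOracle (cube d a) ε b v)) v)
  rw [Finset.sum_const, Finset.card_univ, Fintype.card_pi, Finset.prod_const, Fintype.card_bool,
    Finset.card_univ, Fintype.card_fin, nsmul_eq_mul] at h2
  push_cast at h2
  exact (ENNReal.mul_le_mul_iff_right (by positivity) (by simp)).1 h2

end Error

end InfoOpt

theorem theoremt (d r T : ℕ) (p : ℝ≥0∞) (D B : ℝ)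
    (hd : 1 ≤ d) (hr : 1 ≤ r) (hp : 1 ≤ p) (hp' : p ≤ 2) (hD : 0 < D) (hB : 0 < B)
    (hT : (d : ℝ) / (6 * (r : ℝ)) ≤ (T : ℝ)) :
    ENNReal.ofReal
        ((1 / (12 * Real.sqrt 58)) * (D * B / Real.sqrt (T : ℝ)) *
          Real.sqrt ((d : ℝ) / (min d r : ℕ)))
      ≤ ⨆ X ∈ InfoOpt.domains d p D,
          InfoOpt.minmaxError X (InfoOpt.convexLipschitzFamily p B X) T
            (InfoOpt.commChannels d r) := by
  have hd0 : (0 : ℝ) < d := by exact_mod_cast hd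
  have hr0 : (0 : ℝ) < r := by exact_mod_cast hr
  have hT0 : (0 : ℝ) < T := lt_of_lt_of_le (by positivity) hT
  have hT1 : (1 : ℝ) ≤ T := by exact_mod_cast (Nat.cast_pos.1 hT0 : 0 < T)
  have hm0 : (0 : ℝ) < (min d r : ℕ) := by exact_mod_cast lt_min hd hr
  set q := p.conjExponent with hq
  set u := (d : ℝ) ^ (1 / p.toReal) with hu
  set w := (d : ℝ) ^ (1 / q.toReal) with hw
  have hu0 : 0 < u := by positivity
  have hw0 : 0 < w := by positivity
  have huw : u * w = d := by
    have : Fact (1 ≤ p) := ⟨hp⟩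
    rw [hu, hw, ← Real.rpow_add hd0]
    have : 1 / p.toReal + 1 / q.toReal = 1 := by
      have h := congrArg ENNReal.toReal (ENNReal.HolderConjugate.inv_add_inv_eq_one p q)
      rwa [ENNReal.toReal_add (by simp [(zero_lt_one.trans_le hp).ne'])
        (by simp [hq, ENNReal.conjExponent]), ENNReal.toReal_inv, ENNReal.toReal_inv,
        ENNReal.toReal_one, ← one_div, ← one_div] at h
    rw [this, Real.rpow_one]
  -- The scales for which the cube has `ℓ_p` diameter `D` and the oracle answers have `ℓ_q` norm `B`.
  set a := D / (2 * u) with ha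
  set b := B / w with hb
  have ha0 : 0 < a := by positivity
  have hb0 : 0 < b := by positivity
  set x := (d : ℝ) / (T * (min d r : ℕ)) with hx
  have hx0 : 0 < x := by positivity
  have hx6 : x ≤ 6 := by
    rw [hx, div_le_iff₀ (by positivity)]
    rw [div_le_iff₀ (by positivity)] at hT
    rcases le_total d r with h | h
    · rw [min_eq_left h]; nlinarith
    · rw [min_eq_right h]; linarith
  -- The largest bias, up to a constant, for which `T` outputs do not reveal most of the signs.
  set ε := √x / 10 with hε
  have hε0 : 0 < ε := by positivity
  have hε2 : ε ^ 2 = x / 100 := by rw [hε, div_pow, Real.sq_sqrt hx0.le]; norm_num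
  have hε' : ε ≤ 1 / 4 := by nlinarith
  have hεT : ε ^ 2 * (T * (min d r : ℕ)) ≤ d / 100 := by
    rw [hε2, hx]
    field_simp
    rfl
  have hdom : InfoOpt.cube d a ∈ InfoOpt.domains d p D :=
    InfoOpt.cube_mem_domains hp ha0.le (le_of_eq (by rw [← hu, ha]; field_simp))
  refine le_trans ?_ (le_iSup₂ (InfoOpt.cube d a) hdom)
  refine le_iInf fun Ω => le_iInf fun _ => le_iInf fun μ => le_iInf fun _ => le_iInf fun π =>
    le_iInf fun S => ?_
  refine le_trans (le_trans (ENNReal.ofReal_le_ofReal ?_)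
    (InfoOpt.le_iSup_optError (by simp) μ π S (fun _ h => h) ha0.le hb0.le hε0 hε' hεT))
    (iSup_le fun v => le_iSup₂_of_le _ (InfoOpt.signLoss_mem_convexLipschitzFamily
      hdom.2.2.1 hε0.le hε' hb0.le (le_of_eq (by rw [← hq, ← hw, hb]; field_simp)) v) le_rfl)
  have hab : a * b * d = D * B / 2 := by rw [ha, hb, ← huw]; field_simp
  have hsqrt : √x = √((d : ℝ) / (min d r : ℕ)) / √(T : ℝ) := by
    rw [← Real.sqrt_div' _ hT0.le, hx, div_div, mul_comm (T : ℝ)]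
  have h58 : (7 : ℝ) ≤ √58 := Real.le_sqrt_of_sq_le (by norm_num)
  calc 1 / (12 * √58) * (D * B / √(T : ℝ)) * √((d : ℝ) / (min d r : ℕ))
      = 1 / (12 * √58) * (D * B * √x) := by rw [hsqrt]; ring
    _ ≤ 1 / 50 * (D * B * √x) := by
        gcongr
        linarith
    _ = 2 / 5 * (a * b * d * ε) := by rw [hab, hε]; ring
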